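/- All digraphs have no loops and no parallel arcs. An oriented graph is a (non-empty, finite or infinite) digraph without directed cycles of length two, and an oriented tree is an oriented graph whose underlying undirected graph is a finite tree. For a digraph $D$, the minimum semidegree $\delta^0(D)$ is the minimum of all in-degrees and out-degrees of the vertices of $D$. The maximum degree $\Delta(T)$ of an oriented tree $T$ is the maximum degree of its underlying undirected graph. The girth of an oriented graph is the length of a shortest cycle in its underlying undirected graph (so cycles of every orientation count, and the girth is $\infty$ if there is no cycle). **Theorem.** Let $k\ge 0$ and $\ell\ge 1$ be integers, let $T$ be an oriented tree with $k$ edges, and let $D$ be an oriented graph with $$\delta^0(D)\ \ge\ \max\{k/\ell,\ \Delta(T)\}.$$ If the girth of $D$ is at least $2\ell+1$, then $D$ contains $T$ as a subgraph, that is, there is an injective map $f\colon V(T)\to V(D)$ such that $(f(u),f(v))$ is an arc of $D$ whenever $(u,v)$ is an arc of $T$. -/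

import Mathlib

open scoped ENNReal

namespace Digraph

/-- An oriented graph: a digraph with no loops and no directed cycles of length two.
(The case `u = v` of the condition excludes loops.) -/
def IsOriented {V : Type*} (D : Digraph V) : Prop :=
  ∀ ⦃u v : V⦄, D.Adj u v → ¬ D.Adj v u

/-- An oriented tree: an oriented graph whose underlying undirected graph is a tree. -/
def IsOrientedTree {V : Type*} (T : Digraph V) : Prop :=
  T.IsOriented ∧ T.toSimpleGraphInclusive.IsTree

/-- The set of arcs (directed edges) of a digraph. -/
def arcSet {V : Type*} (D : Digraph V) : Set (V × V) :=
  {p | D.Adj p.1 p.2}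

/-- The out-neighbourhood of a vertex. -/
def outNeighborSet {V : Type*} (D : Digraph V) (v : V) : Set V :=
  {w | D.Adj v w}

/-- The in-neighbourhood of a vertex. -/
def inNeighborSet {V : Type*} (D : Digraph V) (v : V) : Set V :=
  {w | D.Adj w v}

/-- The out-degree of a vertex (`⊤` if it has infinitely many out-neighbours). -/
noncomputable def outDegree {V : Type*} (D : Digraph V) (v : V) : ℕ∞ :=
  (D.outNeighborSet v).encard

/-- The in-degree of a vertex (`⊤` if it has infinitely many in-neighbours). -/
noncomputable def inDegree {V : Type*} (D : Digraph V) (v : V) : ℕ∞ :=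
  (D.inNeighborSet v).encard

/-- The minimum semidegree: the minimum of all in-degrees and out-degrees of the vertices. -/
noncomputable def minSemidegree {V : Type*} (D : Digraph V) : ℕ∞ :=
  ⨅ v, min (D.outDegree v) (D.inDegree v)

open Classical in
/-- The maximum degree of a finite digraph: the maximum degree of its underlying graph. -/
noncomputable def maxDegree {V : Type*} [Fintype V] (D : Digraph V) : ℕ :=
  D.toSimpleGraphInclusive.maxDegree

/-- The girth of an oriented graph: the length of a shortest cycle of its underlying
undirected graph (cycles of any orientation count), and `⊤` if there is no cycle. -/
noncomputable def girth {V : Type*} (D : Digraph V) : ℕ∞ :=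
  D.toSimpleGraphInclusive.egirth

/-- `D` contains `T` as a (not necessarily induced) subgraph: some injective map of the vertices
sends arcs to arcs, preserving their direction. -/
def Contains {V W : Type*} (D : Digraph V) (T : Digraph W) : Prop :=
  ∃ f : W → V, Function.Injective f ∧ ∀ ⦃u v : W⦄, T.Adj u v → D.Adj (f u) (f v)

end Digraph

/-! Choose an integer `d` with every in- and out-degree of `D` at least `d`, every degree of `T` at
most `d`, and `T` having at most `d * ℓ + 1` vertices. These bounds on `T` pass to subtrees, so one
may induct on the number of vertices (`contains_of_card_le`): cut off a branch, embed the rest, and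
attach the branch again. If the diameter of `T` is at most `2 * ℓ`, the branch is a leaf at the end
of a longest path. Its neighbour has at most `d - 1` other neighbours, so a suitable arc remains at
its image. This arc cannot end in the image of the rest, since a tree path would close it to a cycle
of length at most `2 * ℓ`. If the diameter is larger, the branch has height at most `ℓ` and is
chosen so that many other vertices lie near its attachment vertex `w` (`exists_branch_large_ball`).
It is grown greedily from a free neighbour of the image of `w`. Obstructions are measured by
`blockers`, sets of vertices of `T` rather than of `D`. By the girth bound, the blockers of
different neighbours are disjoint, so their sizes add up to at most the order of `T`. A weighted
form of Hall's theorem (`exists_injOn_of_load_bound`) distributes child branches over neighbours so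
that large branches go where there are few blockers; this drives `exists_branch_embedding`. If the
growth failed at every free neighbour of the image of `w`, the blockers, the cut branch and the ball
around `w` would together exceed `d * ℓ + 1` vertices. -/

namespace SimpleGraph

/-- The vertices that can be reached from `c` by a walk avoiding `p`. -/
def branch {V : Type*} (G : SimpleGraph V) (p c : V) : Set V :=
  {t | ∃ q : G.Walk c t, p ∉ q.support}

/-- Every edge that lies on a cycle lies only on cycles of length at least `n`. -/
def NoCycleShorterThan {V : Type*} (G : SimpleGraph V) (n : ℕ) : Prop :=
  ∀ ⦃y z : V⦄, G.Adj y z → ∀ w : G.Walk z y, s(y, z) ∉ w.edges → n ≤ w.length + 1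

/-! ### Girth as a condition on closed walks. -/

section General

variable {V : Type*} {G : SimpleGraph V}

/-- Shortcutting the walk to a path gives a genuine cycle. Hence closed walks glued from several
pieces can be used later without checking that their vertices are distinct, as long as one edge is
not repeated. -/
lemma noCycleShorterThan_of_le_egirth {n : ℕ} (h : (n : ℕ∞) ≤ G.egirth) :
    G.NoCycleShorterThan n := by
  classical
  intro y z hyz w hw
  have hc := Path.cons_isCycle w.toPath hyz (fun h' => hw (w.edges_bypass_subset_edges h'))
  have h1 := h.trans (egirth_le_length hc)
  have h2 : (w.toPath : G.Walk z y).length ≤ w.length := w.length_bypass_le_length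
  rw [Walk.length_cons] at h1
  have h3 : n ≤ (w.toPath : G.Walk z y).length + 1 := by exact_mod_cast h1
  omega

/-- Otherwise the part of `q` up to `x`, together with the edges `x y` and `y z`, is a closed walk
of length at most `q.length + 2`. -/
lemma NoCycleShorterThan.notMem_support {n : ℕ} (hG : G.NoCycleShorterThan n) {x y z v : V}
    (hxy : G.Adj x y) (hyz : G.Adj y z) (hzx : z ≠ x) (q : G.Walk z v) (hq : y ∉ q.support)
    (hn : q.length + 2 < n) : x ∉ q.support := by
  classical
  intro hx
  have h := hG hyz ((q.takeUntil x hx).concat hxy) (by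
    rw [Walk.edges_concat]
    simp only [List.concat_eq_append, List.mem_append, List.mem_singleton, not_or]
    refine ⟨fun h => hq (q.support_takeUntil_subset_support hx
      (Walk.fst_mem_support_of_mem_edges _ h)), fun h => ?_⟩
    have := hyz.ne; have := hxy.ne
    grind)
  have := q.length_takeUntil_le_length hx
  rw [Walk.length_concat] at h
  omega

lemma self_mem_branch {p c : V} (h : p ≠ c) : c ∈ G.branch p c :=
  ⟨Walk.nil, by simpa using h⟩

lemma notMem_branch {p c : V} : p ∉ G.branch p c := fun ⟨q, hq⟩ => hq q.end_mem_support

lemma exists_walk_map {W : Type*} {τ : SimpleGraph W} {S : Set W} {f : W → V}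
    (hf : ∀ a ∈ S, ∀ b ∈ S, τ.Adj a b → G.Adj (f a) (f b)) {a b : W} (q : τ.Walk a b)
    (hq : ∀ v ∈ q.support, v ∈ S) :
    ∃ q' : G.Walk (f a) (f b), q'.length = q.length ∧
      ∀ e ∈ q'.edges, ∃ a' ∈ S, ∃ b' ∈ S, τ.Adj a' b' ∧ e = s(f a', f b') := by
  induction q with
  | nil => exact ⟨Walk.nil, rfl, by simp⟩
  | @cons u v w h q ih =>
    obtain ⟨q', h1, h2⟩ := ih (fun v hv => hq v (by simp [hv]))
    have hu := hq u (by simp)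
    have hv := hq v (by simp)
    refine ⟨Walk.cons (hf _ hu _ hv h) q', by simp [h1], fun e he => ?_⟩
    rw [Walk.edges_cons, List.mem_cons] at he
    rcases he with rfl | he
    · exact ⟨u, hu, v, hv, h, rfl⟩
    · exact h2 e he

end General

/-! ### Branches of a tree and distances across the edge that cuts them off. -/

section Tree

variable {W : Type*} {τ : SimpleGraph W} {p c : W}

lemma IsTree.mem_edges (hτ : τ.IsTree) {y z : W} (hyz : τ.Adj y z) (w : τ.Walk z y) :
    s(y, z) ∈ w.edges := by
  have h := isAcyclic_iff_forall_adj_isBridge.1 hτ.isAcyclic hyz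
  rw [isBridge_iff_forall_walk_mem_edges] at h
  have := h w.reverse
  simpa using this

lemma Connected.mem_branch_swap (hτ : τ.Connected) (hpc : p ≠ c) {t : W}
    (ht : t ∉ τ.branch p c) : t ∈ τ.branch c p := by
  classical
  obtain ⟨q, hq⟩ := (hτ.preconnected p t).exists_isPath
  by_contra hcon
  have hc : c ∈ q.support := by
    by_contra h
    exact hcon ⟨q, h⟩
  cases q with
  | nil => simp at hc; exact hpc hc.symm
  | cons h q =>
    rw [Walk.cons_isPath_iff] at hq
    rw [Walk.support_cons, List.mem_cons] at hc
    have hc := hc.resolve_left (Ne.symm hpc)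
    exact ht ⟨q.dropUntil c hc, fun h' => hq.2 (q.support_dropUntil_subset_support hc h')⟩

/-- The edge `p c` is a bridge, so it is the only edge between the branch and its complement. -/
lemma IsTree.eq_of_adj_of_mem_branch (hτ : τ.IsTree) (hpc : τ.Adj p c) {a b : W}
    (hab : τ.Adj a b) (ha : a ∉ τ.branch p c) (hb : b ∈ τ.branch p c) : a = p ∧ b = c := by
  obtain ⟨q, hq⟩ := hb
  have hap : a = p := by
    by_contra h
    exact ha ⟨q.concat hab.symm, by
      rw [Walk.support_concat]
      simp only [List.mem_append, List.mem_singleton, not_or]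
      exact ⟨hq, Ne.symm h⟩⟩
  subst hap
  refine ⟨rfl, ?_⟩
  have h := hτ.mem_edges hpc (q.concat hab.symm)
  rw [Walk.edges_concat] at h
  simp only [List.concat_eq_append, List.mem_append, List.mem_singleton] at h
  rcases h with h | h
  · exact absurd (Walk.fst_mem_support_of_mem_edges _ h) hq
  · have := hab.ne; have := hpc.ne
    grind

lemma IsTree.dist_eq_dist_add_dist (hτ : τ.IsTree) (hpc : τ.Adj p c) {s t : W}
    (ht : t ∈ τ.branch p c) (hs : s ∉ τ.branch p c) :
    τ.dist s t = τ.dist s p + (τ.dist c t + 1) := by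
  classical
  have hconn := hτ.connected
  -- Every walk entering the branch uses the bridge `p c`. Applied to a geodesic from `s` this
  -- splits it at `p`; applied to a geodesic from `p` it splits that one at `c`.
  have key : ∀ s' ∉ τ.branch p c, ∀ w : τ.Walk s' t, s(p, c) ∈ w.edges := by
    intro s' hs' w
    obtain ⟨q, hq⟩ := ht
    obtain ⟨q', hq'⟩ := hconn.mem_branch_swap hpc.ne hs'
    have h := hτ.mem_edges hpc ((q.append w.reverse).append q'.reverse)
    simp only [Walk.edges_append, List.mem_append, Walk.edges_reverse, List.mem_reverse] at h
    rcases h with (h | h) | h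
    · exact absurd (Walk.fst_mem_support_of_mem_edges _ h) hq
    · exact h
    · exact absurd (Walk.snd_mem_support_of_mem_edges _ h) hq'
  have split : ∀ {u v x : W} (w : τ.Walk u v), x ∈ w.support →
      τ.dist u x + τ.dist x v ≤ w.length := by
    intro u v x w hx
    have h := congrArg Walk.length (w.take_spec hx)
    rw [Walk.length_append] at h
    have h1 := dist_le (w.takeUntil x hx)
    have h2 := dist_le (w.dropUntil x hx)
    omega
  obtain ⟨w, hw⟩ := hconn.exists_walk_length_eq_dist s t
  obtain ⟨w', hw'⟩ := hconn.exists_walk_length_eq_dist p t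
  have h1 := split w (Walk.fst_mem_support_of_mem_edges _ (key s hs w))
  have h2 := split w' (Walk.snd_mem_support_of_mem_edges _ (key p notMem_branch w'))
  have h3 : τ.dist p c = 1 := dist_eq_one_iff_adj.2 hpc
  have h4 : τ.dist s t ≤ τ.dist s p + τ.dist p t := hconn.dist_triangle
  have h5 : τ.dist p t ≤ τ.dist p c + τ.dist c t := hconn.dist_triangle
  omega

lemma IsTree.dist_eq_dist_add_one (hτ : τ.IsTree) (hpc : τ.Adj p c) {t : W}
    (ht : t ∈ τ.branch p c) : τ.dist p t = τ.dist c t + 1 := by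
  rw [hτ.dist_eq_dist_add_dist hpc ht notMem_branch, dist_self, zero_add]

/-- A geodesic that visited the branch would have to cross `p c` in both directions, which makes it
too long. -/
lemma IsTree.exists_walk_notMem_branch (hτ : τ.IsTree) (hpc : τ.Adj p c) {a b : W}
    (ha : a ∉ τ.branch p c) (hb : b ∉ τ.branch p c) :
    ∃ q : τ.Walk a b, (∀ v ∈ q.support, v ∉ τ.branch p c) ∧ q.length = τ.dist a b := by
  classical
  obtain ⟨q, hq⟩ := hτ.connected.exists_walk_length_eq_dist a b
  refine ⟨q, fun v hv hvb => ?_, hq⟩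
  have h := congrArg Walk.length (q.take_spec hv)
  rw [Walk.length_append] at h
  have h1 := dist_le (q.takeUntil v hv)
  have h2 := dist_le (q.dropUntil v hv)
  have h3 := hτ.dist_eq_dist_add_dist hpc hvb ha
  have h4 := hτ.dist_eq_dist_add_dist hpc hvb hb
  have h5 : τ.dist a b ≤ τ.dist a p + τ.dist p b := hτ.connected.dist_triangle
  rw [dist_comm (v := b)] at h2
  rw [dist_comm (u := p) (v := b)] at h5
  omega

lemma IsTree.induce_compl_branch (hτ : τ.IsTree) (hpc : τ.Adj p c) :
    (τ.induce (τ.branch p c)ᶜ).IsTree := by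
  refine ⟨?_, hτ.isAcyclic.induce _⟩
  rw [connected_iff]
  refine ⟨fun a b => ?_, ⟨⟨p, notMem_branch⟩⟩⟩
  obtain ⟨q, hq, -⟩ := hτ.exists_walk_notMem_branch hpc a.2 b.2
  exact ⟨q.induce _ hq⟩

lemma IsTree.branch_subset_branch (hτ : τ.IsTree) (hpc : τ.Adj p c) {c' : W}
    (hcc : τ.Adj c c') (hne : c' ≠ p) : τ.branch c c' ⊆ τ.branch p c := by
  classical
  rintro t ⟨q, hq⟩
  refine ⟨Walk.cons hcc q, ?_⟩
  rw [Walk.support_cons, List.mem_cons, not_or]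
  refine ⟨hpc.ne, fun hp => ?_⟩
  have h := hτ.mem_edges hcc ((q.takeUntil p hp).concat hpc)
  rw [Walk.edges_concat] at h
  simp only [List.concat_eq_append, List.mem_append, List.mem_singleton] at h
  rcases h with h | h
  · exact hq (q.support_takeUntil_subset_support hp (Walk.fst_mem_support_of_mem_edges _ h))
  · have := hpc.ne; have := hcc.ne
    grind

lemma eq_or_exists_mem_branch {t : W} (ht : t ∈ τ.branch p c) :
    t = c ∨ ∃ c', τ.Adj c c' ∧ c' ≠ p ∧ t ∈ τ.branch c c' := by
  classical
  obtain ⟨q, hq⟩ := ht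
  have hq2 : p ∉ q.bypass.support := fun h => hq (q.support_bypass_subset_support h)
  have hq3 := q.bypass_isPath
  cases hq4 : q.bypass with
  | nil => exact Or.inl rfl
  | @cons _ c' _ h q' =>
    rw [hq4, Walk.cons_isPath_iff] at hq3
    rw [hq4, Walk.support_cons, List.mem_cons, not_or] at hq2
    exact Or.inr ⟨c', h, fun h' => hq2.2 (h' ▸ q'.start_mem_support), q', hq3.2⟩

lemma IsTree.disjoint_branch (hτ : τ.IsTree) {c' c'' : W} (h' : τ.Adj c c') (h'' : τ.Adj c c'')
    (hne : c' ≠ c'') : Disjoint (τ.branch c c') (τ.branch c c'') := by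
  rw [Set.disjoint_left]
  rintro t ⟨q', hq'⟩ ⟨q'', hq''⟩
  have h := hτ.mem_edges h' ((q'.append q''.reverse).concat h''.symm)
  rw [Walk.edges_concat] at h
  simp only [List.concat_eq_append, List.mem_append, List.mem_singleton, Walk.edges_append,
    Walk.edges_reverse, List.mem_reverse] at h
  rcases h with (h | h) | h
  · exact hq' (Walk.fst_mem_support_of_mem_edges _ h)
  · exact hq'' (Walk.fst_mem_support_of_mem_edges _ h)
  · have := h'.ne; have := h''.ne
    grind

end Tree

/-! ### Geodesics, balls, and the choice of the branch to cut off. -/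

section Ball

variable {W : Type*} {τ : SimpleGraph W}

lemma IsTree.mem_branch_of_dist_lt (hτ : τ.IsTree) {p c s : W} (hpc : τ.Adj p c)
    (h : τ.dist s c < τ.dist s p) : s ∈ τ.branch p c := by
  by_contra hs
  have := hτ.dist_eq_dist_add_dist hpc (self_mem_branch hpc.ne) hs
  omega

/-- The vertices of a shortest path from `a` to `b`. -/
lemma Connected.exists_geodesic (hτ : τ.Connected) (a b : W) :
    ∃ w : ℕ → W, w 0 = a ∧ w (τ.dist a b) = b ∧ (∀ i < τ.dist a b, τ.Adj (w i) (w (i + 1))) ∧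
      (∀ i ≤ τ.dist a b, τ.dist a (w i) = i) ∧
      (∀ i ≤ τ.dist a b, τ.dist b (w i) = τ.dist a b - i) ∧
      (∀ i j, i ≤ j → j ≤ τ.dist a b → τ.dist (w i) (w j) ≤ j - i) := by
  obtain ⟨P, hP⟩ := hτ.exists_walk_length_eq_dist a b
  have hadj : ∀ i < τ.dist a b, τ.Adj (P.getVert i) (P.getVert (i + 1)) :=
    fun i hi => P.adj_getVert_succ (hP ▸ hi)
  have hij : ∀ i j, i ≤ j → j ≤ τ.dist a b →
      τ.dist (P.getVert i) (P.getVert j) ≤ j - i := by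
    intro i j hij
    induction j, hij using Nat.le_induction with
    | base => simp
    | succ j hj ih =>
      intro h
      have h1 := ih (by omega)
      have h2 : τ.dist (P.getVert j) (P.getVert (j + 1)) = 1 :=
        dist_eq_one_iff_adj.2 (hadj j (by omega))
      have h3 : τ.dist (P.getVert i) (P.getVert (j + 1)) ≤
        τ.dist (P.getVert i) (P.getVert j) + _ := hτ.dist_triangle
      omega
  have h0 : P.getVert 0 = a := P.getVert_zero
  have hL : P.getVert (τ.dist a b) = b := by rw [← hP]; exact P.getVert_length
  refine ⟨P.getVert, h0, hL, hadj, fun i hi => ?_, fun i hi => ?_, hij⟩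
  all_goals
    have h1 := hij 0 i (by omega) hi
    have h2 := hij i _ hi le_rfl
    have h3 : τ.dist a b ≤ τ.dist a (P.getVert i) + τ.dist (P.getVert i) b := hτ.dist_triangle
    rw [h0] at h1
    rw [hL] at h2
    have h4 : τ.dist (P.getVert i) b = τ.dist b (P.getVert i) := dist_comm
    omega

lemma Connected.succ_le_ncard_ball [Finite W] (hτ : τ.Connected) {u v : W} {r : ℕ}
    (h : r ≤ τ.dist u v) : r + 1 ≤ {t | τ.dist u t ≤ r}.ncard := by
  classical
  obtain ⟨w, -, -, -, hw, -⟩ := hτ.exists_geodesic u v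
  have hinj : Set.InjOn w (Finset.range (r + 1)) := by
    intro i hi j hj hij
    simp only [Finset.coe_range, Set.mem_Iio] at hi hj
    rw [← hw i (by omega), ← hw j (by omega), hij]
  have := Set.ncard_le_ncard (s := ((Finset.range (r + 1)).image w : Finset W))
    (t := {t | τ.dist u t ≤ r}) (by
      intro t ht
      simp only [Finset.coe_image, Set.mem_image, Finset.coe_range, Set.mem_Iio] at ht
      obtain ⟨i, hi, rfl⟩ := ht
      simp only [Set.mem_ofPred_eq]
      rw [hw i (by omega)]
      omega) (Set.toFinite _)
  rwa [Set.ncard_coe_finset, Finset.card_image_of_injOn hinj, Finset.card_range] at this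

/-- In a tree of diameter greater than `2 * ℓ` some edge `w c` cuts off a branch of height at most
`ℓ` such that the rest of the ball of radius `ℓ` around `w` is large. -/
lemma IsTree.exists_branch_large_ball [Finite W] (hτ : τ.IsTree) {a b : W} {ℓ : ℕ} (hℓ : 1 ≤ ℓ)
    (hmax : ∀ s t, τ.dist s t ≤ τ.dist a b) (hL : 2 * ℓ + 1 ≤ τ.dist a b) :
    ∃ w c, τ.Adj w c ∧ 2 ≤ (τ.neighborSet w).ncard ∧
      (∀ t ∈ τ.branch w c, τ.dist w t ≤ ℓ) ∧
      ℓ * ((τ.neighborSet w).ncard - 1) + 1 ≤ {t | t ∉ τ.branch w c ∧ τ.dist w t ≤ ℓ}.ncard := by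
  classical
  obtain ⟨w, h0, hb, hadj, hda, hdb, hdw⟩ := hτ.connected.exists_geodesic a b
  set L := τ.dist a b with hLdef
  -- The vertex `w i` has least degree among the first `ℓ` inner vertices of a longest path, so each
  -- of these contributes at least as many neighbours to the ball as `w i` would.
  obtain ⟨i, hi, hmin⟩ := Finset.exists_min_image (Finset.Icc 1 ℓ)
    (fun j => (τ.neighborSet (w j)).ncard) ⟨1, by simp [hℓ]⟩
  rw [Finset.mem_Icc] at hi
  have hprev : ∀ j, 1 ≤ j → j ≤ L → τ.Adj (w j) (w (j - 1)) := by
    intro j hj hj'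
    have := (hadj (j - 1) (by omega)).symm
    rwa [Nat.sub_add_cancel hj] at this
  have hnext := hadj i (by omega)
  have hprevi := hprev i hi.1 (by omega)
  have hne : w (i - 1) ≠ w (i + 1) := by
    intro h
    have h1 := hda (i - 1) (by omega)
    have h2 := hda (i + 1) (by omega)
    rw [h] at h1
    omega
  have hab : ∀ j, 1 ≤ j → j ≤ L → a ∈ τ.branch (w j) (w (j - 1)) := by
    intro j hj hj'
    apply hτ.mem_branch_of_dist_lt (hprev j hj hj')
    rw [hda _ (by omega), hda _ hj']
    omega
  have hbb : b ∈ τ.branch (w i) (w (i + 1)) := by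
    apply hτ.mem_branch_of_dist_lt hnext
    rw [hdb _ (by omega), hdb _ (by omega)]
    omega
  have hbc : ∀ c, τ.Adj (w i) c → c ≠ w (i + 1) → b ∉ τ.branch (w i) c := fun c hc hcne h =>
    Set.disjoint_left.1 (hτ.disjoint_branch hc hnext hcne) h hbb
  have hbdist : ∀ c, τ.Adj (w i) c → c ≠ w (i + 1) → ∀ t ∈ τ.branch (w i) c,
      τ.dist b t = (L - i) + τ.dist (w i) t ∧ 1 ≤ τ.dist (w i) t := by
    intro c hc hcne t ht
    have h1 := hτ.dist_eq_dist_add_dist hc ht (hbc c hc hcne)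
    have h2 := hτ.dist_eq_dist_add_one hc ht
    rw [hdb i (by omega)] at h1
    omega
  -- A vertex of such a branch at distance more than `i` from `w i` would be at distance more than
  -- `L` from `b`.
  have hheight : ∀ c, τ.Adj (w i) c → c ≠ w (i + 1) → ∀ t ∈ τ.branch (w i) c,
      τ.dist (w i) t ≤ ℓ := by
    intro c hc hcne t ht
    have h1 := (hbdist c hc hcne t ht).1
    have h2 := hmax b t
    omega
  have h2 : ({w (i - 1), w (i + 1)} : Set W).ncard ≤ (τ.neighborSet (w i)).ncard :=
    Set.ncard_le_ncard (by
      rintro t (rfl | rfl)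
      · exact hprevi
      · exact hnext) (Set.toFinite _)
  rw [Set.ncard_pair hne] at h2
  have hafter : ∀ c, τ.Adj (w i) c → c ≠ w (i + 1) → ∀ j, i ≤ j → j ≤ L →
      w j ∉ τ.branch (w i) c := by
    intro c hc hcne j hj hj' hmem
    have h3 := hbdist c hc hcne _ hmem
    rw [hdb j hj'] at h3
    omega
  -- If `w i` has degree two, cut off the side of `a`; then `w i, ..., w (i + ℓ)` are the `ℓ + 1`
  -- required vertices. Otherwise cut off a branch that leaves the path.
  rcases h2.eq_or_lt with hdeg | hdeg
  · refine ⟨w i, w (i - 1), hprevi, h2, hheight _ hprevi hne, ?_⟩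
    rw [← hdeg]
    have hinj : Set.InjOn (fun j => w (i + j)) (Finset.range (ℓ + 1)) := by
      intro j hj k hk hjk
      simp only [Finset.coe_range, Set.mem_Iio] at hj hk
      have h3 := hda (i + j) (by omega)
      have h4 := hda (i + k) (by omega)
      simp only at hjk
      rw [hjk] at h3
      omega
    have := Set.ncard_le_ncard
      (s := ((Finset.range (ℓ + 1)).image (fun j => w (i + j)) : Finset W))
      (t := {t | t ∉ τ.branch (w i) (w (i - 1)) ∧ τ.dist (w i) t ≤ ℓ}) (by
        intro t ht
        simp only [Finset.coe_image, Set.mem_image, Finset.coe_range, Set.mem_Iio] at ht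
        obtain ⟨j, hj, rfl⟩ := ht
        refine ⟨hafter _ hprevi hne _ (by omega) (by omega), ?_⟩
        have := hdw i (i + j) (by omega) (by omega)
        omega) (Set.toFinite _)
    rw [Set.ncard_coe_finset, Finset.card_image_of_injOn hinj, Finset.card_range] at this
    omega
  · obtain ⟨c, hc, hcn⟩ := Set.exists_mem_notMem_of_ncard_lt_ncard
      (s := ({w (i - 1), w (i + 1)} : Set W)) (t := τ.neighborSet (w i))
      (by rw [Set.ncard_pair hne]; exact hdeg)
    simp only [Set.mem_insert_iff, Set.mem_singleton_iff, not_or] at hcn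
    have hc' : τ.Adj (w i) c := hc
    refine ⟨w i, c, hc', h2, hheight _ hc' hcn.2, ?_⟩
    have hac : a ∉ τ.branch (w i) c := fun h =>
      Set.disjoint_left.1 (hτ.disjoint_branch hc' hprevi hcn.1) h (hab i hi.1 (by omega))
    have hbefore : ∀ j ≤ i, w j ∉ τ.branch (w i) c := by
      intro j hj hmem
      have h3 := hτ.dist_eq_dist_add_dist hc' hmem hac
      rw [hda j (by omega), hda i (by omega)] at h3
      omega
    have hout : ∀ j ≤ L, w j ∉ τ.branch (w i) c := fun j hj => by
      rcases le_total i j with h | h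
      · exact hafter c hc' hcn.2 j h hj
      · exact hbefore j h
    have := Fintype.ofFinite W
    -- These are the neighbours of `w j` other than `w (j - 1)`; the distance from `a` makes the
    -- sets disjoint.
    let X : ℕ → Finset W := fun j => Finset.univ.filter fun t => τ.Adj (w j) t ∧ τ.dist a t = j + 1
    have hX : ∀ j ∈ Finset.Icc 1 ℓ, (τ.neighborSet (w i)).ncard - 1 ≤ (X j).card := by
      intro j hj
      have hj1 := hmin j hj
      rw [Finset.mem_Icc] at hj
      have h3 : (τ.neighborSet (w j) \ {w (j - 1)}).ncard ≤ (X j : Set W).ncard := by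
        refine Set.ncard_le_ncard ?_ (Set.toFinite _)
        rintro t ⟨ht, htn⟩
        have ht' : τ.Adj (w j) t := ht
        simp only [X, Finset.coe_filter, Finset.mem_univ, true_and, Set.mem_ofPred_eq]
        refine ⟨ht', ?_⟩
        have hat : a ∉ τ.branch (w j) t := fun h =>
          Set.disjoint_left.1 (hτ.disjoint_branch ht' (hprev j hj.1 (by omega)) htn) h
            (hab j hj.1 (by omega))
        rw [hτ.dist_eq_dist_add_dist ht' (self_mem_branch ht'.ne) hat, hda j (by omega), dist_self]
      rw [Set.ncard_coe_finset, Set.ncard_sdiff_singleton_of_mem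
        (show w (j - 1) ∈ τ.neighborSet (w j) from hprev j hj.1 (by omega))] at h3
      omega
    have hdisj : Set.PairwiseDisjoint (Finset.Icc 1 ℓ : Set ℕ) X := by
      intro j _ k _ hjk
      rw [Function.onFun, Finset.disjoint_left]
      intro t ht ht'
      simp only [X, Finset.mem_filter, Finset.mem_univ, true_and] at ht ht'
      omega
    have hcard : ℓ * ((τ.neighborSet (w i)).ncard - 1) ≤ ((Finset.Icc 1 ℓ).biUnion X).card := by
      rw [Finset.card_biUnion hdisj]
      have := Finset.card_nsmul_le_sum (Finset.Icc 1 ℓ) (fun j => (X j).card) _ hX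
      simpa using this
    have hdU : ∀ t ∈ (Finset.Icc 1 ℓ).biUnion X, 2 ≤ τ.dist a t := by
      intro t ht
      simp only [X, Finset.mem_biUnion, Finset.mem_Icc, Finset.mem_filter, Finset.mem_univ,
        true_and] at ht
      obtain ⟨j, hj, -, h⟩ := ht
      omega
    have hd0 := hda 0 (by omega)
    have hd1 := hda 1 (by omega)
    have h1n : w 1 ∉ (Finset.Icc 1 ℓ).biUnion X := fun h => by
      have := hdU _ h
      omega
    have h0n : w 0 ∉ insert (w 1) ((Finset.Icc 1 ℓ).biUnion X) := by
      rw [Finset.mem_insert, not_or]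
      refine ⟨fun h => ?_, fun h => ?_⟩
      · rw [h] at hd0
        omega
      · have := hdU _ h
        omega
    -- The only vertex of the branch that can occur here is `c`. Adding `w 0` and `w 1` and erasing
    -- `c` leaves a net gain of at least one, the `+ 1` of the claim.
    have hsub : (((insert (w 0) (insert (w 1) ((Finset.Icc 1 ℓ).biUnion X))).erase c : Finset W) :
        Set W) ⊆ {t | t ∉ τ.branch (w i) c ∧ τ.dist (w i) t ≤ ℓ} := by
      intro t ht
      simp only [Finset.mem_coe, Finset.mem_erase, Finset.mem_insert, Finset.mem_biUnion,
        Finset.mem_Icc] at ht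
      obtain ⟨htc, rfl | rfl | ⟨j, hj, htj⟩⟩ := ht
      · refine ⟨hout 0 (by omega), ?_⟩
        have := hdw 0 i (by omega) (by omega)
        rw [dist_comm]
        omega
      · refine ⟨hout 1 (by omega), ?_⟩
        have := hdw 1 i (by omega) (by omega)
        rw [dist_comm]
        omega
      · simp only [X, Finset.mem_filter, Finset.mem_univ, true_and] at htj
        refine ⟨fun hmem => htc (hτ.eq_of_adj_of_mem_branch hc' htj.1 (hout j (by omega)) hmem).2,
          ?_⟩
        have h3 : τ.dist (w i) t ≤ τ.dist (w i) (w j) + τ.dist (w j) t :=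
          hτ.connected.dist_triangle
        have h4 : τ.dist (w j) t = 1 := dist_eq_one_iff_adj.2 htj.1
        have h5 : τ.dist (w i) (w j) ≤ ℓ - 1 := by
          rcases le_total i j with h | h
          · have := hdw i j h (by omega)
            omega
          · have := hdw j i h (by omega)
            rw [dist_comm]
            omega
        omega
    have h3 := Set.ncard_le_ncard hsub (Set.toFinite _)
    rw [Set.ncard_coe_finset] at h3
    have h4 := Finset.pred_card_le_card_erase
      (s := insert (w 0) (insert (w 1) ((Finset.Icc 1 ℓ).biUnion X))) (a := c)
    rw [Finset.card_insert_of_notMem h0n, Finset.card_insert_of_notMem h1n] at h4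
    omega

end Ball

end SimpleGraph

/-! ### Counting disjoint sets and a weighted matching lemma. -/

lemma Set.sum_ncard_le_ncard {ι α : Type*} [Finite α] (I : Finset ι) (f : ι → Set α) {A : Set α}
    (hd : ∀ i ∈ I, ∀ j ∈ I, i ≠ j → Disjoint (f i) (f j)) (hA : ∀ i ∈ I, f i ⊆ A) :
    ∑ i ∈ I, (f i).ncard ≤ A.ncard := by
  classical
  have := Fintype.ofFinite α
  simp only [Set.ncard_eq_toFinset_card']
  rw [← Finset.card_biUnion]
  · apply Finset.card_le_card
    intro x hx
    obtain ⟨i, hi, hx⟩ := Finset.mem_biUnion.1 hx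
    rw [Set.mem_toFinset] at hx ⊢
    exact hA i hi hx
  · intro i hi j hj hij
    rw [Function.onFun, Set.disjoint_toFinset]
    exact hd i hi j hj hij

lemma Set.exists_finset_card_eq_of_le_encard {α : Type*} {s : Set α} {n : ℕ}
    (h : (n : ℕ∞) ≤ s.encard) : ∃ F : Finset α, (F : Set α) ⊆ s ∧ F.card = n := by
  obtain ⟨t, hts, ht⟩ := Set.exists_subset_encard_eq h
  have hfin : t.Finite := Set.finite_of_encard_eq_coe ht
  refine ⟨hfin.toFinset, by simpa using hts, ?_⟩
  rw [hfin.encard_eq_coe_toFinset_card] at ht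
  exact_mod_cast ht

/-- A weighted matching lemma: items of sizes `s i` can be matched to places with loads `m z` such
that each pair obeys the same kind of bound as the total load and the total size. -/
lemma exists_injOn_of_load_bound {ι α : Type*} [Nonempty α] (I : Finset ι) (Z : Finset α)
    (m : α → ℕ) (s : ι → ℕ) {e X B N : ℕ} (hI : I.card ≤ e) (hZ : Z.card = e)
    (hs : ∀ i ∈ I, 1 ≤ s i) (hN : ∑ i ∈ I, s i + 1 ≤ N) (hB : ∑ z ∈ Z, m z ≤ B)
    (h : B = 0 ∨ e * B + N < e * (X + 1) + 1) :
    ∃ g : ι → α, Set.InjOn g I ∧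
      ∀ i ∈ I, g i ∈ Z ∧ (m (g i) = 0 ∨ e * m (g i) + s i < e * X + 1) := by
  classical
  let t : I → Finset α := fun i => Z.filter fun z => m z = 0 ∨ e * m z + s i < e * X + 1
  -- Hall's condition. If it fails for `J`, the smallest item of `J` has fewer than `J.card`
  -- admissible places, so there are bad places, each carrying at least the load of the lightest
  -- one.
  have hall : ∀ J : Finset I, J.card ≤ (J.biUnion t).card := by
    intro J
    rcases J.eq_empty_or_nonempty with rfl | hJ
    · simp
    by_contra! hcon
    obtain ⟨i, hiJ, hi⟩ := Finset.exists_min_image J (fun i => s i) hJ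
    have h1 : (t i).card < J.card :=
      (Finset.card_le_card (Finset.subset_biUnion_of_mem t hiJ)).trans_lt hcon
    let bad := Z.filter fun z => ¬ (m z = 0 ∨ e * m z + s i < e * X + 1)
    have h2 : (t i).card + bad.card = e := by
      rw [← hZ]
      exact Finset.card_filter_add_card_filter_not _
    have hJe : J.card ≤ e := by
      have := J.card_le_univ
      rw [Fintype.card_coe] at this
      omega
    have hbad : bad.Nonempty := Finset.card_pos.1 (by omega)
    obtain ⟨z, hz, hzmin⟩ := Finset.exists_min_image bad m hbad
    have hz' := (Finset.mem_filter.1 hz).2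
    push Not at hz'
    have h3 : bad.card * m z ≤ B := by
      have h4 := Finset.card_nsmul_le_sum bad m _ hzmin
      have h5 : ∑ z ∈ bad, m z ≤ ∑ z ∈ Z, m z :=
        Finset.sum_le_sum_of_subset (Finset.filter_subset _ _)
      rw [smul_eq_mul] at h4
      exact h4.trans (h5.trans hB)
    have h4 : J.card * s i + 1 ≤ N := by
      have h5 := Finset.card_nsmul_le_sum J (fun i => s i) _ hi
      have h6 : ∑ i ∈ J, s i ≤ ∑ i ∈ I, s i := by
        rw [← Finset.sum_coe_sort I]
        exact Finset.sum_le_sum_of_subset (Finset.subset_univ _)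
      rw [smul_eq_mul] at h5
      omega
    have hm1 : 1 ≤ m z := Nat.one_le_iff_ne_zero.2 hz'.1
    have hb1 : 1 ≤ bad.card := hbad.card_pos
    have hs1 := hs i i.2
    have hB1 : 1 ≤ B := (Nat.mul_le_mul hb1 hm1).trans h3
    have h5 := h.resolve_left (by omega)
    -- Two bad places double the load `m z` in `B`. A single one forces `J.card = e`, and then `N`
    -- is at least `e * s i + 1 ≥ e + s i`. Either way `h5` is violated.
    rcases Nat.lt_or_ge bad.card 2 with hb | hb
    · have hbc : bad.card = 1 := by omega
      have hJc : J.card = e := by omega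
      rw [hbc] at h3
      rw [hJc] at h4
      have h6 : e * m z ≤ e * B := Nat.mul_le_mul_left _ (by omega)
      have h7 : e + s i ≤ e * s i + 1 := by nlinarith
      nlinarith [hz'.2]
    · have h6 : e * (2 * m z) ≤ e * B :=
        Nat.mul_le_mul_left _ ((Nat.mul_le_mul_right _ hb).trans h3)
      have h7 : s i ≤ J.card * s i := Nat.le_mul_of_pos_left _ hJ.card_pos
      have h8 : e ≤ e * m z := Nat.le_mul_of_pos_right _ hm1
      nlinarith [hz'.2]
  obtain ⟨g, hg, hgt⟩ := (Finset.all_card_le_biUnion_card_iff_exists_injective t).1 hall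
  refine ⟨fun i => if h : i ∈ I then g ⟨i, h⟩ else Classical.arbitrary α, ?_, ?_⟩
  · intro i hi j hj hij
    rw [Finset.mem_coe] at hi hj
    simp only [hi, hj, dif_pos] at hij
    simpa using hg hij
  · intro i hi
    have := hgt ⟨i, hi⟩
    simp only [t, Finset.mem_filter] at this
    simpa only [hi, dif_pos] using this

/-! ### Blockers and their disjointness. -/

namespace SimpleGraph

variable {V W : Type*} {G : SimpleGraph V} {τ : SimpleGraph W}

/-- The vertices of `τ` near those vertices of `S` whose images under `f` are the first ones met on
a walk that starts at `y` and avoids `x`; `r` bounds the total distance. -/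
def blockers (G : SimpleGraph V) (τ : SimpleGraph W) (f : W → V) (S : Set W) (r : ℕ) (x y : V) :
    Set W :=
  {t | ∃ u ∈ S, ∃ p : G.Walk y (f u), x ∉ p.support ∧
    (∀ v ∈ p.support, v ∈ f '' S → v = f u) ∧ p.length + τ.dist u t ≤ r}

/-- Any two vertices of `S` are joined, in the image of `τ[S]` under `f`, by a walk whose length is
their distance in `τ`. -/
def MapsGeodesics (G : SimpleGraph V) (τ : SimpleGraph W) (f : W → V) (S : Set W) : Prop :=
  ∀ a ∈ S, ∀ b ∈ S, ∃ q : G.Walk (f a) (f b), q.length = τ.dist a b ∧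
    ∀ e ∈ q.edges, ∃ a' ∈ S, ∃ b' ∈ S, τ.Adj a' b' ∧ e = s(f a', f b')

variable {f : W → V} {S : Set W} {n r : ℕ}

/-- Prepend the edge `y z` to the walk. The girth keeps `x` off it, and since `y` is free the first
image vertex met stays the same. -/
lemma blockers_subset_blockers (hG : G.NoCycleShorterThan n) {x y z : V} (hxy : G.Adj x y)
    (hyz : G.Adj y z) (hzx : z ≠ x) (hy : y ∉ f '' S) (hn : r + 2 < n) :
    G.blockers τ f S r y z ⊆ G.blockers τ f S (r + 1) x y := by
  rintro t ⟨u, hu, p, hp, hpS, hl⟩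
  refine ⟨u, hu, Walk.cons hyz p, ?_, ?_, ?_⟩
  · rw [Walk.support_cons, List.mem_cons, not_or]
    exact ⟨hxy.ne, hG.notMem_support hxy hyz hzx p hp (by omega)⟩
  · intro v hv hvS
    rw [Walk.support_cons, List.mem_cons] at hv
    rcases hv with rfl | hv
    · exact absurd hvS hy
    · exact hpS v hv hvS
  · rw [Walk.length_cons]
    omega

/-- For a common `t`, the two walks, the image of the tree path from `u` to `u'` and the two edges
at `y` form a closed walk. The tree path is no longer than the detour through `t`, so the total is
at most `2 * r + 2`. -/
lemma disjoint_blockers (hG : G.NoCycleShorterThan n) (hτ : τ.Connected)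
    (hmap : G.MapsGeodesics τ f S) {y z z' : V} (hyz : G.Adj y z) (hyz' : G.Adj y z')
    (hne : z ≠ z') (hS : ∀ a ∈ S, ∀ b ∈ S, τ.Adj a b → s(y, z) ≠ s(f a, f b))
    (hn : 2 * r + 2 < n) :
    Disjoint (G.blockers τ f S r y z) (G.blockers τ f S r y z') := by
  rw [Set.disjoint_left]
  rintro t ⟨u, hu, p, hp, -, hl⟩ ⟨u', hu', p', hp', -, hl'⟩
  obtain ⟨q, hq, hqe⟩ := hmap u hu u' hu'
  have h := hG hyz (((p.append q).append p'.reverse).concat hyz'.symm) (by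
    rw [Walk.edges_concat]
    simp only [List.concat_eq_append, List.mem_append, List.mem_singleton, Walk.edges_append,
      Walk.edges_reverse, List.mem_reverse, not_or]
    refine ⟨⟨⟨fun h => hp (Walk.fst_mem_support_of_mem_edges _ h), fun h => ?_⟩,
      fun h => hp' (Walk.fst_mem_support_of_mem_edges _ h)⟩, fun h => ?_⟩
    · obtain ⟨a, ha, b, hb, hab, he⟩ := hqe _ h
      exact hS a ha b hb hab he
    · rw [Sym2.eq_iff] at h
      rcases h with ⟨-, h⟩ | ⟨-, h⟩
      · exact hyz.ne h.symm
      · exact hne h)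
  simp only [Walk.length_concat, Walk.length_append, Walk.length_reverse] at h
  have h1 : τ.dist u u' ≤ τ.dist u t + τ.dist t u' := hτ.dist_triangle
  have h2 : τ.dist t u' = τ.dist u' t := dist_comm
  omega

lemma disjoint_blockers_ball (hG : G.NoCycleShorterThan n) (hτ : τ.Connected)
    (hmap : G.MapsGeodesics τ f S) {w : W} (hw : w ∈ S) {y : V} (hy : G.Adj (f w) y)
    (hS : ∀ a ∈ S, ∀ b ∈ S, τ.Adj a b → s(f w, y) ≠ s(f a, f b)) {k : ℕ}
    (hn : r + k + 1 < n) :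
    Disjoint (G.blockers τ f S r (f w) y) {t | τ.dist w t ≤ k} := by
  rw [Set.disjoint_left]
  rintro t ⟨u, hu, p, hp, -, hl⟩ hwt
  obtain ⟨q, hq, hqe⟩ := hmap u hu w hw
  have h := hG hy (p.append q) (by
    simp only [Walk.edges_append, List.mem_append, not_or]
    refine ⟨fun h => hp (Walk.fst_mem_support_of_mem_edges _ h), fun h => ?_⟩
    obtain ⟨a, ha, b, hb, hab, he⟩ := hqe _ h
    exact hS a ha b hb hab he)
  rw [Walk.length_append] at h
  have h1 : τ.dist u w ≤ τ.dist u t + τ.dist t w := hτ.dist_triangle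
  have h2 : τ.dist t w = τ.dist w t := dist_comm
  have h3 : τ.dist w t ≤ k := hwt
  omega

/-- An occupied vertex has a whole ball of blockers, so a vertex with few blockers must be free. -/
lemma ball_subset_blockers {u : W} (hu : u ∈ S) {x : V} (hx : x ≠ f u) :
    {t | τ.dist u t ≤ r} ⊆ G.blockers τ f S r x (f u) := by
  intro t ht
  exact ⟨u, hu, Walk.nil, by simpa using hx, by simp, by simpa using ht⟩

end SimpleGraph

/-! ### Directions of arcs and the greedy embedding of a branch. -/

namespace Digraph

variable {V W : Type*}

/-- `D.Arc true u v` says that `u v` is an arc, and `D.Arc false u v` that `v u` is an arc. -/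
def Arc (D : Digraph V) (b : Bool) (u v : V) : Prop :=
  bif b then D.Adj u v else D.Adj v u

lemma IsOriented.adj_toSimpleGraphInclusive {D : Digraph V} (hD : D.IsOriented) {u v : V} :
    D.toSimpleGraphInclusive.Adj u v ↔ D.Adj u v ∨ D.Adj v u := by
  rw [toSimpleGraphInclusive, SimpleGraph.fromRel_adj]
  refine ⟨And.right, fun h => ⟨?_, h⟩⟩
  rintro rfl
  rcases h with h | h <;> exact hD h h

lemma IsOriented.adj_of_arc {D : Digraph V} (hD : D.IsOriented) {b : Bool} {u v : V}
    (h : D.Arc b u v) : D.toSimpleGraphInclusive.Adj u v := by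
  rw [hD.adj_toSimpleGraphInclusive]
  cases b
  · exact Or.inr h
  · exact Or.inl h

lemma IsOriented.exists_arc {D : Digraph V} (hD : D.IsOriented) {u v : V}
    (h : D.toSimpleGraphInclusive.Adj u v) : ∃ b, D.Arc b u v := by
  rcases hD.adj_toSimpleGraphInclusive.1 h with h | h
  · exact ⟨true, h⟩
  · exact ⟨false, h⟩

lemma IsOriented.arc_unique {D : Digraph V} (hD : D.IsOriented) {b b' : Bool} {u v : V}
    (h : D.Arc b u v) (h' : D.Arc b' u v) : b = b' := by
  cases b <;> cases b' <;> first | rfl | exact (hD h h').elim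

open SimpleGraph

/-- A branch of the tree `T` can be embedded at `y`, away from the neighbour `x` of `y` and from the
image of `S`, if there are few blockers. -/
theorem exists_branch_embedding [Finite W] {D : Digraph V} {T : Digraph W} {e ℓ : ℕ}
    (hD : D.IsOriented) (hT : T.IsOrientedTree)
    (hG : D.toSimpleGraphInclusive.NoCycleShorterThan (2 * ℓ + 1))
    (hTdeg : ∀ v, (T.toSimpleGraphInclusive.neighborSet v).ncard ≤ e + 1)
    (hDdeg : ∀ b v, ((e + 1 : ℕ) : ℕ∞) ≤ {w | D.Arc b v w}.encard)
    {f : W → V} {S : Set W}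
    (hmap : D.toSimpleGraphInclusive.MapsGeodesics T.toSimpleGraphInclusive f S)
    (hball : ∀ u, ∀ r < ℓ, r + 1 ≤ {t | T.toSimpleGraphInclusive.dist u t ≤ r}.ncard) :
    ∀ r < ℓ, ∀ p c, T.toSimpleGraphInclusive.Adj p c →
      (∀ t ∈ T.toSimpleGraphInclusive.branch p c, T.toSimpleGraphInclusive.dist p t ≤ r + 1) →
      ∀ x y, D.toSimpleGraphInclusive.Adj x y →
      ((D.toSimpleGraphInclusive.blockers T.toSimpleGraphInclusive f S r x y).ncard = 0 ∨
        e * (D.toSimpleGraphInclusive.blockers T.toSimpleGraphInclusive f S r x y).ncard +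
          (T.toSimpleGraphInclusive.branch p c).ncard < e * (r + 1) + 1) →
      ∃ g : W → V, g c = y ∧ Set.InjOn g (T.toSimpleGraphInclusive.branch p c) ∧
        (∀ a ∈ T.toSimpleGraphInclusive.branch p c, ∀ b ∈ T.toSimpleGraphInclusive.branch p c,
          T.Adj a b → D.Adj (g a) (g b)) ∧
        ∀ t ∈ T.toSimpleGraphInclusive.branch p c, ∃ q : D.toSimpleGraphInclusive.Walk y (g t),
          x ∉ q.support ∧ q.length ≤ r ∧ ∀ v ∈ q.support, v ∉ f '' S := by
  classical
  set G := D.toSimpleGraphInclusive with hGdef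
  set τ := T.toSimpleGraphInclusive with hτdef
  have hτ : τ.IsTree := hT.2
  -- If `y` were occupied, `hball` would give at least `r + 1` blockers, and the branch is nonempty,
  -- so both alternatives would fail.
  have hfree : ∀ r < ℓ, ∀ p c, τ.Adj p c → ∀ x y, G.Adj x y →
      ((G.blockers τ f S r x y).ncard = 0 ∨
        e * (G.blockers τ f S r x y).ncard + (τ.branch p c).ncard < e * (r + 1) + 1) →
      y ∉ f '' S := by
    rintro r hr p c hpc x y hxy h ⟨u, hu, rfl⟩
    have h1 := (hball u r hr).trans
      (Set.ncard_le_ncard (ball_subset_blockers (G := G) hu hxy.ne) (Set.toFinite _))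
    have h2 : 0 < (τ.branch p c).ncard :=
      (Set.ncard_pos (Set.toFinite _)).2 ⟨c, self_mem_branch hpc.ne⟩
    have h3 := Nat.mul_le_mul_left e h1
    omega
  intro r
  induction r with
  | zero =>
    rintro hr p c hpc hh x y hxy h
    have hy := hfree 0 hr p c hpc x y hxy h
    have hsub : ∀ t ∈ τ.branch p c, t = c := by
      intro t ht
      have h1 := hτ.dist_eq_dist_add_one hpc ht
      have h2 := hh t ht
      exact ((hτ.connected.dist_eq_zero_iff).1 (by omega)).symm
    refine ⟨fun _ => y, rfl, ?_, ?_, ?_⟩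
    · intro a ha b hb _
      rw [hsub a ha, hsub b hb]
    · intro a ha b hb hab
      rw [hsub a ha, hsub b hb] at hab
      exact (hT.1 hab hab).elim
    · intro t ht
      refine ⟨Walk.nil, by simpa using hxy.ne, by simp, ?_⟩
      intro v hv
      rw [Walk.support_nil, List.mem_singleton] at hv
      exact hv ▸ hy
  | succ r ih =>
    rintro hr p c hpc hh x y hxy h
    have hy := hfree (r + 1) hr p c hpc x y hxy h
    have := Fintype.ofFinite W
    have : Nonempty V := ⟨y⟩
    -- Children of `c`, separated by direction: out-children must go to out-neighbours of `y`,
    -- in-children to in-neighbours. The two matchings cannot collide because `D` is oriented.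
    let C : Bool → Finset W := fun b => Finset.univ.filter fun c' => T.Arc b c c' ∧ c' ≠ p
    have hC : ∀ {b c'}, c' ∈ C b ↔ T.Arc b c c' ∧ c' ≠ p := by simp [C]
    have hCadj : ∀ {b c'}, c' ∈ C b → τ.Adj c c' := fun h => hT.1.adj_of_arc (hC.1 h).1
    have hmatch : ∀ b, ∃ g : W → V, Set.InjOn g (C b) ∧ ∀ c' ∈ C b,
        (D.Arc b y (g c') ∧ g c' ≠ x) ∧
        ((G.blockers τ f S r y (g c')).ncard = 0 ∨
          e * (G.blockers τ f S r y (g c')).ncard + (τ.branch c c').ncard < e * (r + 1) + 1) := by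
      intro b
      obtain ⟨F, hF, hFcard⟩ := Set.exists_finset_card_eq_of_le_encard (hDdeg b y)
      -- One of the `e + 1` neighbours may be `x`, which leaves `e` places; likewise `p` uses up one
      -- of the at most `e + 1` neighbours of `c`.
      obtain ⟨Z, hZF, hZcard⟩ := Finset.exists_subset_card_eq (s := F.erase x) (n := e) (by
        have := Finset.pred_card_le_card_erase (s := F) (a := x)
        omega)
      have hZ : ∀ z ∈ Z, D.Arc b y z ∧ z ≠ x := fun z hz =>
        ⟨hF (Finset.mem_of_mem_erase (hZF hz)), Finset.ne_of_mem_erase (hZF hz)⟩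
      have hCcard : (C b).card ≤ e := by
        have h1 : ((insert p (C b) : Finset W) : Set W).ncard ≤ (τ.neighborSet c).ncard := by
          refine Set.ncard_le_ncard ?_ (Set.toFinite _)
          intro c' hc'
          rw [Finset.mem_coe, Finset.mem_insert] at hc'
          rcases hc' with rfl | hc'
          · exact hpc.symm
          · exact hCadj hc'
        rw [Set.ncard_coe_finset, Finset.card_insert_of_notMem (fun h => (hC.1 h).2 rfl)] at h1
        have := hTdeg c
        omega
      have hsum : ∑ c' ∈ C b, (τ.branch c c').ncard + 1 ≤ (τ.branch p c).ncard := by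
        have h1 := Set.sum_ncard_le_ncard (C b) (fun c' => τ.branch c c')
          (A := τ.branch p c \ {c})
          (fun i hi j hj hij => hτ.disjoint_branch (hCadj hi) (hCadj hj) hij)
          (fun i hi t ht => ⟨hτ.branch_subset_branch hpc (hCadj hi) (hC.1 hi).2 ht, by
            rintro rfl
            exact notMem_branch ht⟩)
        have h2 := Set.ncard_sdiff_singleton_add_one (s := τ.branch p c)
          (self_mem_branch hpc.ne) (Set.toFinite _)
        omega
      have hload : ∑ z ∈ Z, (G.blockers τ f S r y z).ncard ≤
          (G.blockers τ f S (r + 1) x y).ncard := by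
        refine Set.sum_ncard_le_ncard Z (fun z => G.blockers τ f S r y z) ?_ ?_
        · intro z hz z' hz' hzz
          refine disjoint_blockers hG hτ.connected hmap (hD.adj_of_arc (hZ z hz).1)
            (hD.adj_of_arc (hZ z' hz').1) hzz ?_ (by omega)
          intro a ha b hb hab heq
          rw [Sym2.eq_iff] at heq
          rcases heq with ⟨h, -⟩ | ⟨h, -⟩
          · exact hy ⟨a, ha, h.symm⟩
          · exact hy ⟨b, hb, h.symm⟩
        · intro z hz
          exact blockers_subset_blockers hG hxy (hD.adj_of_arc (hZ z hz).1) (hZ z hz).2 hy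
            (by omega)
      obtain ⟨g, hg, hgC⟩ := exists_injOn_of_load_bound (C b) Z _
        (fun c' => (τ.branch c c').ncard) (X := r + 1) hCcard hZcard
        (fun c' hc' => (Set.ncard_pos (Set.toFinite _)).2 ⟨c', self_mem_branch (hCadj hc').ne⟩)
        hsum hload h
      exact ⟨g, hg, fun c' hc' => ⟨hZ _ (hgC c' hc').1, (hgC c' hc').2⟩⟩
    choose g hginj hgC using hmatch
    have hext : ∀ b c', c' ∈ C b → ∃ k : W → V, k c' = g b c' ∧ Set.InjOn k (τ.branch c c') ∧
        (∀ a ∈ τ.branch c c', ∀ b ∈ τ.branch c c', T.Adj a b → D.Adj (k a) (k b)) ∧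
        ∀ t ∈ τ.branch c c', ∃ q : G.Walk (g b c') (k t),
          y ∉ q.support ∧ q.length ≤ r ∧ ∀ v ∈ q.support, v ∉ f '' S := by
      intro b c' hc'
      refine ih (by omega) c c' (hCadj hc') ?_ y (g b c') (hD.adj_of_arc (hgC b c' hc').1.1)
        (hgC b c' hc').2
      intro t ht
      have h1 := hτ.branch_subset_branch hpc (hCadj hc') (hC.1 hc').2 ht
      have h2 := hh t h1
      have h3 := hτ.dist_eq_dist_add_one hpc h1
      omega
    choose! k hkc hkinj hkadj hkwalk using hext
    have hchild : ∀ t, ∃ bc : Bool × W, t ∈ τ.branch p c → t ≠ c →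
        bc.2 ∈ C bc.1 ∧ t ∈ τ.branch c bc.2 := by
      intro t
      by_cases ht : t ∈ τ.branch p c ∧ t ≠ c
      · obtain ⟨c', h1, h2, h3⟩ := (eq_or_exists_mem_branch ht.1).resolve_left ht.2
        obtain ⟨b, hb⟩ := hT.1.exists_arc h1
        exact ⟨(b, c'), fun _ _ => ⟨hC.2 ⟨hb, h2⟩, h3⟩⟩
      -- A dummy value for vertices that lie in no child branch.
      · exact ⟨(true, c), fun h1 h2 => absurd ⟨h1, h2⟩ ht⟩
    choose κ hκ using hchild
    let F : W → V := fun t => if t = c then y else k (κ t).1 (κ t).2 t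
    have hFc : F c = y := if_pos rfl
    have hFk : ∀ b c', c' ∈ C b → ∀ t ∈ τ.branch c c', F t = k b c' t := by
      intro b c' hc' t ht
      have htc : t ≠ c := by
        rintro rfl
        exact notMem_branch ht
      obtain ⟨h1, h2⟩ := hκ t (hτ.branch_subset_branch hpc (hCadj hc') (hC.1 hc').2 ht) htc
      have h3 : (κ t).2 = c' := by
        by_contra hne
        exact Set.disjoint_left.1 (hτ.disjoint_branch (hCadj h1) (hCadj hc') hne) h2 ht
      have h4 : (κ t).1 = b := by
        rw [h3] at h1
        exact hT.1.arc_unique (hC.1 h1).1 (hC.1 hc').1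
      simp only [F, if_neg htc, h3, h4]
    have hcases : ∀ t ∈ τ.branch p c, t = c ∨ ∃ b c', c' ∈ C b ∧ t ∈ τ.branch c c' := by
      intro t ht
      by_cases htc : t = c
      · exact Or.inl htc
      · exact Or.inr ⟨_, _, hκ t ht htc⟩
    have hFwalk : ∀ b c', c' ∈ C b → ∀ t ∈ τ.branch c c', ∃ q : G.Walk (g b c') (F t),
          y ∉ q.support ∧ q.length ≤ r ∧ ∀ v ∈ q.support, v ∉ f '' S := by
      intro b c' hc' t ht
      rw [hFk b c' hc' t ht]
      exact hkwalk b c' hc' t ht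
    have hFne : ∀ b c', c' ∈ C b → ∀ t ∈ τ.branch c c', F t ≠ y := by
      intro b c' hc' t ht hty
      obtain ⟨q, hq, -, -⟩ := hFwalk b c' hc' t ht
      exact hq (hty ▸ q.end_mem_support)
    refine ⟨F, hFc, ?_, ?_, ?_⟩
    · intro s hs t ht hst
      rcases hcases s hs with rfl | ⟨b, c', hc', hs'⟩ <;>
        rcases hcases t ht with rfl | ⟨b', c'', hc'', ht'⟩
      · rfl
      · exact absurd (hst.symm.trans hFc) (hFne b' c'' hc'' t ht')
      · exact absurd (hst.trans hFc) (hFne b c' hc' s hs')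
      · by_cases hcc : c' = c''
        · subst hcc
          have hbb := hT.1.arc_unique (hC.1 hc').1 (hC.1 hc'').1
          subst hbb
          rw [hFk b c' hc' s hs', hFk b c' hc' t ht'] at hst
          exact hkinj b c' hc' hs' ht' hst
        -- A common image of two different child branches would close a walk of length at most `2 *
        -- r + 2` through `y`.
        · exfalso
          have h1 := (hgC b c' hc').1.1
          have h2 := (hgC b' c'' hc'').1.1
          have hne : g b c' ≠ g b' c'' := by
            intro heq
            have hbb : b = b' := hD.arc_unique h1 (heq ▸ h2)
            subst hbb
            exact hcc (hginj b hc' hc'' heq)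
          obtain ⟨q, hq, hl, -⟩ := hFwalk b c' hc' s hs'
          obtain ⟨q', hq', hl', -⟩ := hFwalk b' c'' hc'' t ht'
          have h3 := hG (hD.adj_of_arc h1)
            ((q.append (q'.reverse.copy hst.symm rfl)).concat (hD.adj_of_arc h2).symm) (by
              rw [Walk.edges_concat]
              simp only [List.concat_eq_append, List.mem_append, List.mem_singleton,
                Walk.edges_append, Walk.edges_copy, Walk.edges_reverse, List.mem_reverse, not_or]
              refine ⟨⟨fun h => hq (Walk.fst_mem_support_of_mem_edges _ h),
                fun h => hq' (Walk.fst_mem_support_of_mem_edges _ h)⟩, fun h => ?_⟩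
              rw [Sym2.eq_iff] at h
              rcases h with ⟨-, h⟩ | ⟨-, h⟩
              · exact (hD.adj_of_arc h1).ne h.symm
              · exact hne h)
          simp only [Walk.length_concat, Walk.length_append, Walk.length_copy,
            Walk.length_reverse] at h3
          omega
    · intro s hs t ht hst
      have hadj : τ.Adj s t := hT.1.adj_toSimpleGraphInclusive.2 (Or.inl hst)
      have hroot : ∀ b c', c' ∈ C b → ∀ t ∈ τ.branch c c', τ.Adj c t → t = c' :=
        fun b c' hc' t ht h =>
          (hτ.eq_of_adj_of_mem_branch (hCadj hc') h notMem_branch ht).2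
      have hFc' : ∀ b c', c' ∈ C b → F c' = g b c' := fun b c' hc' => by
        rw [hFk b c' hc' c' (self_mem_branch (hCadj hc').ne), hkc b c' hc']
      rcases hcases s hs with rfl | ⟨b, c', hc', hs'⟩ <;>
        rcases hcases t ht with rfl | ⟨b', c'', hc'', ht'⟩
      · exact (hT.1 hst hst).elim
      · have := hroot b' c'' hc'' t ht' hadj
        subst this
        have hb : b' = true := hT.1.arc_unique (hC.1 hc'').1 (show T.Arc true s t from hst)
        subst hb
        rw [hFc, hFc' true t hc'']
        exact (hgC true t hc'').1.1
      · have := hroot b c' hc' s hs' hadj.symm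
        subst this
        have hb : b = false := hT.1.arc_unique (hC.1 hc').1 (show T.Arc false t s from hst)
        subst hb
        rw [hFc, hFc' false s hc']
        exact (hgC false s hc').1.1
      · have hmem : s ∈ τ.branch c c'' := by
          by_contra hns
          have := (hτ.eq_of_adj_of_mem_branch (hCadj hc'') hadj hns ht').1
          subst this
          exact notMem_branch hs'
        rw [hFk b' c'' hc'' s hmem, hFk b' c'' hc'' t ht']
        exact hkadj b' c'' hc'' s hmem t ht' hst
    · intro t ht
      rcases hcases t ht with rfl | ⟨b, c', hc', ht'⟩
      · rw [hFc]
        refine ⟨Walk.nil, by simpa using hxy.ne, by simp, ?_⟩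
        intro v hv
        rw [Walk.support_nil, List.mem_singleton] at hv
        exact hv ▸ hy
      · obtain ⟨q, hq, hl, hqS⟩ := hFwalk b c' hc' t ht'
        have h1 := (hgC b c' hc').1
        refine ⟨Walk.cons (hD.adj_of_arc h1.1) q, ?_, by rw [Walk.length_cons]; omega, ?_⟩
        · rw [Walk.support_cons, List.mem_cons, not_or]
          exact ⟨hxy.ne, hG.notMem_support hxy (hD.adj_of_arc h1.1) h1.2 q hq (by omega)⟩
        · intro v hv
          rw [Walk.support_cons, List.mem_cons] at hv
          rcases hv with rfl | hv
          · exact hy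
          · exact hqS v hv

end Digraph

/-! ### Gluing the branch to the rest, and the induction on the order of the tree. -/

namespace Digraph

open SimpleGraph

lemma contains_of_branch {V W : Type*} {D : Digraph V} {T : Digraph W} (hT : T.IsOrientedTree)
    {w c : W} {b : Bool} (hwc : T.Arc b w c) {f g : W → V}
    (hf : Set.InjOn f (T.toSimpleGraphInclusive.branch w c)ᶜ)
    (hfT : ∀ a ∉ T.toSimpleGraphInclusive.branch w c, ∀ a' ∉ T.toSimpleGraphInclusive.branch w c,
      T.Adj a a' → D.Adj (f a) (f a'))
    (hg : Set.InjOn g (T.toSimpleGraphInclusive.branch w c))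
    (hgT : ∀ a ∈ T.toSimpleGraphInclusive.branch w c, ∀ a' ∈ T.toSimpleGraphInclusive.branch w c,
      T.Adj a a' → D.Adj (g a) (g a'))
    (hgf : ∀ t ∈ T.toSimpleGraphInclusive.branch w c,
      g t ∉ f '' (T.toSimpleGraphInclusive.branch w c)ᶜ)
    (harc : D.Arc b (f w) (g c)) : D.Contains T := by
  classical
  have hadj := hT.1.adj_of_arc hwc
  refine ⟨fun t => if t ∈ T.toSimpleGraphInclusive.branch w c then g t else f t, ?_, ?_⟩
  · intro s t hst
    by_cases hs : s ∈ T.toSimpleGraphInclusive.branch w c <;>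
      by_cases ht : t ∈ T.toSimpleGraphInclusive.branch w c <;>
      simp only [hs, ht, if_true, if_false] at hst
    · exact hg hs ht hst
    · exact (hgf s hs ⟨t, ht, hst.symm⟩).elim
    · exact (hgf t ht ⟨s, hs, hst⟩).elim
    · exact hf hs ht hst
  · intro s t hst
    have h := hT.1.adj_toSimpleGraphInclusive.2 (Or.inl hst)
    by_cases hs : s ∈ T.toSimpleGraphInclusive.branch w c <;>
      by_cases ht : t ∈ T.toSimpleGraphInclusive.branch w c <;>
      simp only [hs, ht, if_true, if_false]
    · exact hgT s hs t ht hst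
    · obtain ⟨rfl, rfl⟩ := hT.2.eq_of_adj_of_mem_branch hadj h.symm ht hs
      have hb : b = false := hT.1.arc_unique hwc (show T.Arc false t s from hst)
      subst hb
      exact harc
    · obtain ⟨rfl, rfl⟩ := hT.2.eq_of_adj_of_mem_branch hadj h hs ht
      have hb : b = true := hT.1.arc_unique hwc (show T.Arc true s t from hst)
      subst hb
      exact harc
    · exact hfT s hs t ht hst

/-- The map `f` embeds the part of the tree `T` outside the branch at the edge `w c`. The last field
says that an edge at `f w` whose other end is not the image of a neighbour of `w` is not used. -/
structure EmbedsOutsideBranch {V W : Type*} (D : Digraph V) (T : Digraph W) (f : W → V)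
    (w c : W) : Prop where
  injOn : Set.InjOn f (T.toSimpleGraphInclusive.branch w c)ᶜ
  adj : ∀ a ∉ T.toSimpleGraphInclusive.branch w c, ∀ a' ∉ T.toSimpleGraphInclusive.branch w c,
    T.Adj a a' → D.Adj (f a) (f a')
  mapsGeodesics : D.toSimpleGraphInclusive.MapsGeodesics T.toSimpleGraphInclusive f
    (T.toSimpleGraphInclusive.branch w c)ᶜ
  edge_ne : ∀ y ∉ f '' (T.toSimpleGraphInclusive.neighborSet w \ {c}),
    ∀ a ∈ (T.toSimpleGraphInclusive.branch w c)ᶜ, ∀ a' ∈ (T.toSimpleGraphInclusive.branch w c)ᶜ,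
      T.toSimpleGraphInclusive.Adj a a' → s(f w, y) ≠ s(f a, f a')

/-- An oriented tree embeds if its diameter is greater than `2 * ℓ` and all of its subtrees that
arise from cutting off a branch embed. -/
lemma contains_of_large_diam {V W : Type*} [Finite W] {D : Digraph V} {T : Digraph W} {d ℓ : ℕ}
    (hℓ : 1 ≤ ℓ) (hD : D.IsOriented) (hT : T.IsOrientedTree)
    (hG : D.toSimpleGraphInclusive.NoCycleShorterThan (2 * ℓ + 1))
    (hTdeg : ∀ v, (T.toSimpleGraphInclusive.neighborSet v).ncard ≤ d)
    (hDdeg : ∀ b v, (d : ℕ∞) ≤ {w | D.Arc b v w}.encard)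
    (hcard : Nat.card W ≤ d * ℓ + 1) {a b : W}
    (hmax : ∀ s t, T.toSimpleGraphInclusive.dist s t ≤ T.toSimpleGraphInclusive.dist a b)
    (hL : 2 * ℓ + 1 ≤ T.toSimpleGraphInclusive.dist a b)
    (hsub : ∀ w c, T.toSimpleGraphInclusive.Adj w c → ∃ f : W → V,
      D.EmbedsOutsideBranch T f w c) :
    D.Contains T := by
  classical
  set G := D.toSimpleGraphInclusive with hGdef
  set τ := T.toSimpleGraphInclusive with hτdef
  have hτ : τ.IsTree := hT.2
  obtain ⟨w, c, hwc, hdeg, hheight, hlarge⟩ := hτ.exists_branch_large_ball hℓ hmax hL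
  obtain ⟨f, hf, hfT, hmap, hfy⟩ := hsub w c hwc
  obtain ⟨i, harc⟩ := hT.1.exists_arc hwc
  -- As the diameter exceeds `2 * ℓ`, each `u` is at distance at least `r` from `a` or from `b`.
  have hball : ∀ u, ∀ r < ℓ, r + 1 ≤ {t | τ.dist u t ≤ r}.ncard := by
    intro u r hr
    have h1 : τ.dist a b ≤ τ.dist a u + τ.dist u b := hτ.connected.dist_triangle
    rw [dist_comm (u := a) (v := u)] at h1
    rcases Nat.lt_or_ge (τ.dist u a) r with h | h
    · exact hτ.connected.succ_le_ncard_ball (v := b) (by omega)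
    · exact hτ.connected.succ_le_ncard_ball h
  obtain ⟨e, rfl⟩ : ∃ e, d = e + 1 := ⟨d - 1, by have := hTdeg w; omega⟩
  have hdegw := hTdeg w
  set δ := (τ.neighborSet w).ncard
  obtain ⟨F, hF, hFcard⟩ := Set.exists_finset_card_eq_of_le_encard (hDdeg i (f w))
  have hN : (τ.neighborSet w \ {c}).ncard = δ - 1 := Set.ncard_sdiff_singleton_of_mem hwc
  -- Candidates for the image of `c`: neighbours of `f w` in the right direction, minus the images
  -- of the `δ - 1` other neighbours of `w`.
  obtain ⟨Y, hYF, hYcard⟩ := Finset.exists_subset_card_eq (n := e + 1 - (δ - 1))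
    (s := F \ (Set.toFinite (f '' (τ.neighborSet w \ {c}))).toFinset) (by
      have h1 := Finset.le_card_sdiff (Set.toFinite (f '' (τ.neighborSet w \ {c}))).toFinset F
      have h2 := Set.ncard_image_le (f := f) (Set.toFinite (τ.neighborSet w \ {c}))
      rw [← Set.ncard_eq_toFinset_card _ (Set.toFinite (f '' (τ.neighborSet w \ {c})))] at h1
      omega)
  have hY : ∀ y ∈ Y, D.Arc i (f w) y ∧ y ∉ f '' (τ.neighborSet w \ {c}) := by
    intro y hy
    have := hYF hy
    rw [Finset.mem_sdiff, Set.Finite.mem_toFinset] at this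
    exact ⟨hF this.1, this.2⟩
  by_contra hcon
  set s := (τ.branch w c).ncard with hs
  have hs1 : 1 ≤ s := (Set.ncard_pos (Set.toFinite _)).2 ⟨c, self_mem_branch hwc.ne⟩
  have hblock : ∀ y ∈ Y, e * ℓ + 1 ≤
      e * (G.blockers τ f (τ.branch w c)ᶜ (ℓ - 1) (f w) y).ncard + s := by
    intro y hy
    by_contra hlt
    obtain ⟨g, hgc, hg, hgT, hgw⟩ := exists_branch_embedding hD hT hG hTdeg hDdeg hmap hball (ℓ - 1)
      (by omega) w c hwc (fun t ht => (hheight t ht).trans (by omega)) (f w) y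
      (hD.adj_of_arc (hY y hy).1) (Or.inr (by
        rw [Nat.sub_add_cancel hℓ]
        exact not_le.1 hlt))
    refine hcon (contains_of_branch hT harc hf hfT hg hgT (fun t ht => ?_) (hgc ▸ (hY y hy).1))
    obtain ⟨q, -, -, hq⟩ := hgw t ht
    exact hq _ q.end_mem_support
  have hsum := Finset.sum_le_sum hblock
  -- With radius `ℓ - 1` for blockers and `ℓ` for the ball, any overlap would give a closed walk of
  -- length at most `2 * ℓ`, just below the girth.
  have hdisj : ∑ y ∈ Y, (G.blockers τ f (τ.branch w c)ᶜ (ℓ - 1) (f w) y).ncard ≤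
      ({t | τ.dist w t ≤ ℓ}ᶜ : Set W).ncard := by
    refine Set.sum_ncard_le_ncard Y _ ?_ ?_
    · intro y hy y' hy' hne
      exact disjoint_blockers hG hτ.connected hmap (hD.adj_of_arc (hY y hy).1)
        (hD.adj_of_arc (hY y' hy').1) hne (hfy y (hY y hy).2) (by omega)
    · intro y hy
      exact Set.subset_compl_iff_disjoint_right.2 (disjoint_blockers_ball hG hτ.connected hmap
        (show w ∈ (τ.branch w c)ᶜ from notMem_branch) (hD.adj_of_arc (hY y hy).1)
        (hfy y (hY y hy).2) (by omega))
  have hsplit : {t | t ∉ τ.branch w c ∧ τ.dist w t ≤ ℓ}.ncard + s ≤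
      {t | τ.dist w t ≤ ℓ}.ncard := by
    rw [hs, ← Set.ncard_union_eq (Set.disjoint_left.2 fun t ht ht' => ht.1 ht') (Set.toFinite _)
      (Set.toFinite _)]
    refine Set.ncard_le_ncard ?_ (Set.toFinite _)
    rintro t (ht | ht)
    · exact ht.2
    · exact hheight t ht
  have htotal := Set.ncard_add_ncard_compl {t | τ.dist w t ≤ ℓ}
  simp only [Finset.sum_const, smul_eq_mul, Finset.sum_add_distrib, ← Finset.mul_sum,
    hYcard] at hsum
  set B := ∑ y ∈ Y, (G.blockers τ f (τ.branch w c)ᶜ (ℓ - 1) (f w) y).ncard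
  -- There are `m = e - δ'` candidates. Summing `hblock` and dividing by `e` gives `m * ℓ ≤ B + s -
  -- 1`; adding the ball, of size at least `ℓ * (δ' + 1) + 1 + s`, yields at least `(e + 1) * ℓ + 2`
  -- vertices.
  obtain ⟨δ', hδ'⟩ : ∃ δ', δ - 1 = δ' + 1 := ⟨δ - 2, by omega⟩
  obtain ⟨m, hm⟩ : ∃ m, e + 1 - (δ - 1) = m ∧ m + δ' = e := ⟨e - δ', by omega, by omega⟩
  obtain ⟨s', hs'⟩ : ∃ s', s = s' + 1 := ⟨s - 1, by omega⟩
  rw [hδ'] at hlarge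
  rw [hm.1, hs'] at hsum
  have he : 0 < e := by omega
  have h1 : m * s' ≤ e * s' := Nat.mul_le_mul_right _ (by omega)
  have h2 : m * ℓ ≤ B + s' := by
    apply Nat.le_of_mul_le_mul_left _ he
    nlinarith
  have h3 : (e + 1) * ℓ = m * ℓ + ℓ * (δ' + 1) := by
    rw [← hm.2]
    ring
  omega

/-- An oriented tree embeds if its diameter is at most `2 * ℓ` and all of its subtrees that
arise from cutting off a branch embed. -/
lemma contains_of_small_diam {V W : Type*} [Finite W] {D : Digraph V} {T : Digraph W} {d ℓ : ℕ}
    (hD : D.IsOriented) (hT : T.IsOrientedTree)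
    (hG : D.toSimpleGraphInclusive.NoCycleShorterThan (2 * ℓ + 1))
    (hTdeg : ∀ v, (T.toSimpleGraphInclusive.neighborSet v).ncard ≤ d)
    (hDdeg : ∀ b v, (d : ℕ∞) ≤ {w | D.Arc b v w}.encard) {a b : W}
    (hmax : ∀ s t, T.toSimpleGraphInclusive.dist s t ≤ T.toSimpleGraphInclusive.dist a b)
    (hpos : 0 < T.toSimpleGraphInclusive.dist a b)
    (hL : T.toSimpleGraphInclusive.dist a b ≤ 2 * ℓ)
    (hsub : ∀ w c, T.toSimpleGraphInclusive.Adj w c → ∃ f : W → V,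
      D.EmbedsOutsideBranch T f w c) :
    D.Contains T := by
  set G := D.toSimpleGraphInclusive with hGdef
  set τ := T.toSimpleGraphInclusive with hτdef
  have hτ : τ.IsTree := hT.2
  obtain ⟨w, rfl, -, hadj, -, hdb, -⟩ := hτ.connected.exists_geodesic a b
  have hwc : τ.Adj (w 1) (w 0) := (hadj 0 hpos).symm
  have hb0 := hdb 0 (by omega)
  have hb1 := hdb 1 (by omega)
  -- The end of a longest path is a leaf.
  have hleaf : ∀ t ∈ τ.branch (w 1) (w 0), t = w 0 := by
    intro t ht
    have hb : b ∉ τ.branch (w 1) (w 0) := fun h => by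
      have := hτ.dist_eq_dist_add_one hwc h
      rw [dist_comm (v := b), dist_comm (v := b)] at this
      omega
    have h1 := hτ.dist_eq_dist_add_dist hwc ht hb
    have h2 := hmax b t
    exact ((hτ.connected.dist_eq_zero_iff).1 (by omega)).symm
  obtain ⟨f, hf, hfT, hmap, hfy⟩ := hsub _ _ hwc
  obtain ⟨i, harc⟩ := hT.1.exists_arc hwc
  obtain ⟨F, hF, hFcard⟩ := Set.exists_finset_card_eq_of_le_encard (hDdeg i (f (w 1)))
  obtain ⟨y, hyF, hy⟩ := Set.exists_mem_notMem_of_ncard_lt_ncard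
    (s := f '' (τ.neighborSet (w 1) \ {w 0})) (t := (F : Set V)) (by
      have h1 := Set.ncard_image_le (f := f) (Set.toFinite (τ.neighborSet (w 1) \ {w 0}))
      have h2 := Set.ncard_sdiff_singleton_add_one (s := τ.neighborSet (w 1)) hwc (Set.toFinite _)
      have h3 := hTdeg (w 1)
      rw [Set.ncard_coe_finset]
      omega)
  have hyarc : D.Arc i (f (w 1)) y := hF hyF
  -- If `y = f u`, the tree path from `u` to `w 1` has length at most `2 * ℓ - 1`, because `w 0` is
  -- one step further from `u`; its image and the new arc close up too early.
  have hyS : y ∉ f '' (τ.branch (w 1) (w 0))ᶜ := by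
    rintro ⟨u, hu, rfl⟩
    obtain ⟨q, hq, hqe⟩ := hmap u hu (w 1) notMem_branch
    have h1 := hG (hD.adj_of_arc hyarc) q (fun h => by
      obtain ⟨a, ha, b, hb, hab, he⟩ := hqe _ h
      exact hfy _ hy a ha b hb hab he)
    have h2 := hτ.dist_eq_dist_add_dist hwc (self_mem_branch hwc.ne) hu
    have h3 := hmax u (w 0)
    have h4 : q.length = τ.dist u (w 1) := hq
    omega
  refine contains_of_branch hT harc hf hfT (g := fun _ => y) ?_ ?_ (fun _ _ => hyS) hyarc
  · intro s hs t ht _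
    rw [hleaf s hs, hleaf t ht]
  · intro s hs t ht hst
    rw [hleaf s hs, hleaf t ht] at hst
    exact (hT.1 hst hst).elim

/-- The parameter `d` stays fixed while the tree shrinks, so the induction hypothesis applies to
every subtree left after cutting off a branch. -/
theorem contains_of_card_le {V : Type*} [Nonempty V] {D : Digraph V} {d ℓ : ℕ} (hℓ : 1 ≤ ℓ)
    (hD : D.IsOriented) (hG : D.toSimpleGraphInclusive.NoCycleShorterThan (2 * ℓ + 1))
    (hDdeg : ∀ b v, (d : ℕ∞) ≤ {w | D.Arc b v w}.encard) :
    ∀ n ≤ d * ℓ + 1, ∀ {W : Type*} [Finite W] (T : Digraph W), Nat.card W = n →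
      T.IsOrientedTree → (∀ v, (T.toSimpleGraphInclusive.neighborSet v).ncard ≤ d) →
      D.Contains T := by
  classical
  intro n
  induction n using Nat.strong_induction_on with
  | _ n ih =>
  intro hn W _ T hcard hT hTdeg
  have hτ := hT.2
  have := hτ.connected.nonempty
  obtain ⟨⟨a, b⟩, hmax⟩ :=
    Finite.exists_max fun p : W × W => T.toSimpleGraphInclusive.dist p.1 p.2
  replace hmax : ∀ s t, T.toSimpleGraphInclusive.dist s t ≤ T.toSimpleGraphInclusive.dist a b :=
    fun s t => hmax (s, t)
  rcases Nat.eq_zero_or_pos (T.toSimpleGraphInclusive.dist a b) with h0 | hpos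
  · have heq : ∀ s t : W, s = t := fun s t =>
      (hτ.connected.dist_eq_zero_iff).1 (by have := hmax s t; omega)
    refine ⟨fun _ => Classical.arbitrary V, fun s t _ => heq s t, fun s t hst => ?_⟩
    rw [heq s t] at hst
    exact (hT.1 hst hst).elim
  have hsub : ∀ w c, T.toSimpleGraphInclusive.Adj w c → ∃ f : W → V,
      D.EmbedsOutsideBranch T f w c := by
    intro w c hwc
    set τ := T.toSimpleGraphInclusive with hτdef
    set S := (τ.branch w c)ᶜ with hS
    have hcS : c ∉ S := fun h => h (self_mem_branch hwc.ne)
    let T' : Digraph S := ⟨fun s t => T.Adj s t⟩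
    have hT'o : T'.IsOriented := fun s t hst => hT.1 hst
    have hT'τ : T'.toSimpleGraphInclusive = τ.induce S := by
      ext s t
      rw [hT'o.adj_toSimpleGraphInclusive, comap_adj]
      exact hT.1.adj_toSimpleGraphInclusive.symm
    have hlt : Nat.card S < n := by
      rw [← hcard, Nat.card_coe_set_eq, ← Set.ncard_univ]
      exact Set.ncard_lt_ncard (Set.ssubset_univ_iff.2 fun h => hcS (h ▸ Set.mem_univ c))
        (Set.toFinite _)
    obtain ⟨f', hf', hf'T⟩ := ih _ hlt (by omega) T' rfl
      ⟨hT'o, hT'τ ▸ hτ.induce_compl_branch hwc⟩ (fun v => by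
        refine le_trans ?_ (hTdeg v)
        rw [← Set.ncard_image_of_injective _ Subtype.val_injective]
        refine Set.ncard_le_ncard ?_ (Set.toFinite _)
        rintro _ ⟨t, ht, rfl⟩
        rw [hT'τ] at ht
        exact ht)
    let f : W → V := fun t => if h : t ∈ S then f' ⟨t, h⟩ else Classical.arbitrary V
    have hff' : ∀ t (h : t ∈ S), f t = f' ⟨t, h⟩ := fun t h => dif_pos h
    have hinj : Set.InjOn f S := by
      intro s hs t ht hst
      rw [hff' s hs, hff' t ht] at hst
      simpa using hf' hst
    have hfT : ∀ s ∈ S, ∀ t ∈ S, T.Adj s t → D.Adj (f s) (f t) := by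
      intro s hs t ht hst
      rw [hff' s hs, hff' t ht]
      exact hf'T hst
    refine ⟨f, hinj, hfT, ?_, ?_⟩
    · intro s hs t ht
      obtain ⟨q, hqS, hq⟩ := hτ.exists_walk_notMem_branch hwc hs ht
      obtain ⟨q', hq', hqe⟩ := exists_walk_map (G := D.toSimpleGraphInclusive) (S := S) (f := f)
        (fun s hs t ht hst => by
          rw [hD.adj_toSimpleGraphInclusive]
          rw [hT.1.adj_toSimpleGraphInclusive] at hst
          exact hst.imp (hfT s hs t ht) (hfT t ht s hs)) q hqS
      exact ⟨q', hq'.trans hq, hqe⟩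
    -- By injectivity an image edge at `f w` comes from a tree edge at `w`, whose other end is not
    -- `c`.
    · intro y hy s hs t ht hst heq
      have hw : w ∈ S := notMem_branch
      rw [Sym2.eq_iff] at heq
      rcases heq with ⟨h1, h2⟩ | ⟨h1, h2⟩
      · have := hinj hw hs h1
        subst this
        exact hy ⟨t, ⟨hst, fun h => hcS (h ▸ ht)⟩, h2.symm⟩
      · have := hinj hw ht h1
        subst this
        exact hy ⟨s, ⟨hst.symm, fun h => hcS (h ▸ hs)⟩, h2.symm⟩
  rcases Nat.lt_or_ge (2 * ℓ) (T.toSimpleGraphInclusive.dist a b) with hL | hL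
  · exact contains_of_large_diam hℓ hD hT hG hTdeg hDdeg (hcard ▸ hn) hmax hL hsub
  · exact contains_of_small_diam hD hT hG hTdeg hDdeg hmax hpos hL hsub

/-! ### Passing from the stated degree hypotheses to the integer `d`. -/

lemma IsOrientedTree.card_le {W : Type*} [Finite W] {T : Digraph W} (hT : T.IsOrientedTree) :
    Nat.card W ≤ T.arcSet.ncard + 1 := by
  refine hT.2.connected.card_vert_le_card_edgeSet_add_one.trans (Nat.add_le_add_right ?_ 1)
  rw [Nat.card_coe_set_eq]
  refine (Set.ncard_le_ncard ?_ (Set.toFinite _)).trans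
    (Set.ncard_image_le (f := fun p : W × W => s(p.1, p.2)) (Set.toFinite T.arcSet))
  intro e he
  induction e with
  | _ u v =>
    rw [mem_edgeSet, hT.1.adj_toSimpleGraphInclusive] at he
    rcases he with h | h
    · exact ⟨(u, v), h, rfl⟩
    · exact ⟨(v, u), h, Sym2.eq_swap⟩

lemma ncard_neighborSet_le_maxDegree {W : Type*} [Fintype W] (T : Digraph W) (v : W) :
    (T.toSimpleGraphInclusive.neighborSet v).ncard ≤ T.maxDegree := by
  classical
  rw [Set.ncard_eq_toFinset_card']
  refine le_trans (le_of_eq ?_) (T.toSimpleGraphInclusive.degree_le_maxDegree v)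
  rw [← SimpleGraph.card_neighborFinset_eq_degree]
  congr!

/-- The semidegree itself serves as `d` when it is finite; when it is infinite, `max k m` is large
enough. -/
lemma exists_nat_le_minSemidegree {V : Type*} {D : Digraph V} {k ℓ m : ℕ} (hℓ : 1 ≤ ℓ)
    (h : max ((k : ℝ≥0∞) / (ℓ : ℝ≥0∞)) (m : ℝ≥0∞) ≤ (D.minSemidegree : ℝ≥0∞)) :
    ∃ d : ℕ, k ≤ d * ℓ ∧ m ≤ d ∧ (d : ℕ∞) ≤ D.minSemidegree := by
  induction hδ : D.minSemidegree with
  | top => exact ⟨max k m, (le_max_left k m).trans (Nat.le_mul_of_pos_right _ hℓ),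
      le_max_right k m, le_top⟩
  | coe d =>
    rw [hδ, ENat.toENNReal_coe, max_le_iff] at h
    refine ⟨d, ?_, by exact_mod_cast h.2, le_rfl⟩
    have h1 := h.1
    rw [ENNReal.div_le_iff (by exact_mod_cast (by omega : ℓ ≠ 0)) (ENNReal.natCast_ne_top ℓ)] at h1
    exact_mod_cast h1

lemma minSemidegree_le_encard {V : Type*} (D : Digraph V) (b : Bool) (v : V) :
    D.minSemidegree ≤ {w | D.Arc b v w}.encard := by
  refine (iInf_le _ v).trans ?_
  cases b
  · exact min_le_right _ _
  · exact min_le_left _ _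

end Digraph

theorem mainTheorem1 {V W : Type*} [Nonempty V] [Fintype W]
    (D : Digraph V) (T : Digraph W) (k ℓ : ℕ) (hℓ : 1 ≤ ℓ)
    (hT : T.IsOrientedTree) (hk : T.arcSet.ncard = k)
    (hD : D.IsOriented)
    (hdeg : max ((k : ℝ≥0∞) / (ℓ : ℝ≥0∞)) (T.maxDegree : ℝ≥0∞) ≤ (D.minSemidegree : ℝ≥0∞))
    (hgirth : ((2 * ℓ + 1 : ℕ) : ℕ∞) ≤ D.girth) :
    D.Contains T := by
  obtain ⟨d, hkd, hmd, hdδ⟩ := Digraph.exists_nat_le_minSemidegree hℓ hdeg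
  have hcard := hT.card_le
  refine Digraph.contains_of_card_le hℓ hD (SimpleGraph.noCycleShorterThan_of_le_egirth hgirth)
    (fun b v => hdδ.trans (D.minSemidegree_le_encard b v)) (Nat.card W) (by omega) T rfl hT
    (fun v => (T.ncard_neighborSet_le_maxDegree v).trans hmd)
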